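/- Let $0<q<1$, $b<0$ and $n\ge 0$ an integer. Write $(a;q)_k=\prod_{j=0}^{k-1}(1-aq^j)$ and let $$y_n(x;b)={}_2\phi_1(q^{-n},bq^n;0;q,x)=\sum_{k=0}^{n}\frac{(q^{-n};q)_k\,(bq^n;q)_k}{(q;q)_k}\,x^k,\qquad \tilde y_n(x;b)=y_n(qx;b)={}_2\phi_1(q^{-n},bq^n;0;q,qx)$$ be the $q$-Bessel polynomial, in the two normalizations of the argument. For a polynomial $p$ of degree $d$ with only real zeros let $\lambda_1(p)\le\dots\le\lambda_d(p)$ be its zeros, counted with multiplicity; if they are all positive, the logarithmic mesh of $p$ is $\operatorname{lmesh} p=\max_{1\le j\le d-1}\lambda_j(p)/\lambda_{j+1}(p)$ (and $0$ if $d\le 1$). For $p,r$ of the same degree $d$ with only real zeros, $p\preccurlyeq r$ means $\lambda_1(p)\le\lambda_1(r)\le\lambda_2(p)\le\lambda_2(r)\le\dots\le\lambda_d(p)\le\lambda_d(r)$. Then $y_n(x;b)$ and $\tilde y_n(x;b)$ have degree $n$, all their complex zeros lie in the real interval $(0,1)$ (so that the zeros of $y_n(x;b)$ even lie in $(0,q)$),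 and their logarithmic mesh is strictly less than $q$. If moreover $q^2<t<1$, then $$y_n(x;b)\preccurlyeq y_n(x;tb)\qquad\text{and}\qquad \tilde y_n(x;b)\preccurlyeq \tilde y_n(x;tb).$$ -/

import Mathlib

open Polynomial

noncomputable section

/-- The `q`-Pochhammer symbol `(a; q)_k = ∏_{j=0}^{k-1} (1 - a q^j)`. -/
def qPoch (a q : ℝ) (k : ℕ) : ℝ := ∏ j ∈ Finset.range k, (1 - a * q ^ j)

/-- The coefficient of `x ^ k` in the `q`-hypergeometric series with upper parameters `a` and
lower parameters `b`:
`(a; q)_k / (b; q)_k * (-1)^(e k) * q^(e * (k choose 2)) / (q; q)_k`,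
where `e = 1 + (number of lower parameters) - (number of upper parameters)`. -/
def qHypCoeff (a b : List ℝ) (q : ℝ) (k : ℕ) : ℝ :=
  (a.map fun c => qPoch c q k).prod / (b.map fun c => qPoch c q k).prod
    * ((-1) ^ k * q ^ (k.choose 2)) ^ ((b.length : ℤ) + 1 - (a.length : ℤ)) / qPoch q q k

/-- The `q`-hypergeometric series. -/
def qHypSeries (a b : List ℝ) (q x : ℝ) : ℝ := ∑' k : ℕ, qHypCoeff a b q k * x ^ k

/-- The terminating `q`-hypergeometric series with upper parameters `q ^ (-n)` and `a` and lower
parameters `b`, as a polynomial. -/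
def qHypPoly (n : ℕ) (a b : List ℝ) (q : ℝ) : ℝ[X] :=
  ∑ k ∈ Finset.range (n + 1), C (qHypCoeff (q ^ (-(n : ℤ)) :: a) b q k) * X ^ k

/-- The polynomial `₂φ₁(q^{-n}, b q^n; 0; q, x)` in `x`. -/
def qBessel (q : ℝ) (n : ℕ) (b : ℝ) : ℝ[X] := qHypPoly n [b * q ^ n] [0] q

/-- The polynomial `₂φ₁(q^{-n}, b q^n; 0; q, q x)` in `x`. -/
def qBesselDilated (q : ℝ) (n : ℕ) (b : ℝ) : ℝ[X] := (qBessel q n b).comp (C q * X)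

/-- The terminating series is the full series. -/
theorem qHypPoly_eval (n : ℕ) (a b : List ℝ) (q x : ℝ) (hq : q ≠ 0) :
    (qHypPoly n a b q).eval x = qHypSeries (q ^ (-(n : ℤ)) :: a) b q x := by
  have hz : ∀ k ∉ Finset.range (n + 1),
      qHypCoeff (q ^ (-(n : ℤ)) :: a) b q k * x ^ k = 0 := by
    intro k hk
    have hk' : n < k := by simpa using hk
    have h0 : qPoch (q ^ (-(n : ℤ))) q k = 0 := by
      refine Finset.prod_eq_zero (Finset.mem_range.2 hk') ?_
      rw [zpow_neg, zpow_natCast, inv_mul_cancel₀ (pow_ne_zero n hq), sub_self]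
    rw [qHypCoeff, List.map_cons, List.prod_cons, h0]; simp
  rw [qHypSeries, tsum_eq_sum hz, qHypPoly, eval_finsetSum]
  simp

/-- Real polynomials of degree at most `n` all of whose (complex) zeros lie in `K`; the zero
polynomial does not belong to this set. -/
def polysWithZerosIn (n : ℕ) (K : Set ℝ) : Set ℝ[X] :=
  {p | p.natDegree ≤ n ∧ ∀ z : ℂ, aeval z p = 0 → ∃ x ∈ K, (x : ℂ) = z}

/-- The `k`-th real zero of `p` (counting from `k = 0`), the zeros being listed in increasing order
with multiplicity. -/
def zeroAt (p : ℝ[X]) (k : ℕ) : ℝ := (p.roots.sort (· ≤ ·)).getD k 0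

/-- The logarithmic mesh of a polynomial with positive zeros: the largest ratio of two consecutive
zeros. For a polynomial with fewer than two zeros there is no such ratio and the value is `0`. -/
def lmesh (p : ℝ[X]) : ℝ := ⨆ j : Fin (p.natDegree - 1), zeroAt p (j : ℕ) / zeroAt p ((j : ℕ) + 1)

/-- The polynomials in `polysWithZerosIn n K` with logarithmic mesh strictly less than `q`
(for `K` a set of positive numbers). -/
def polysWithMesh (n : ℕ) (q : ℝ) (K : Set ℝ) : Set ℝ[X] :=
  {p | p ∈ polysWithZerosIn n K ∧ lmesh p < q}

/-- `Interlaces p r` is the relation `p ≼ r`: both polynomials have only real zeros, and either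
the degrees agree and `λ₁(p) ≤ λ₁(r) ≤ λ₂(p) ≤ ⋯ ≤ λₙ(p) ≤ λₙ(r)`, or the degree of `r` is one less
than that of `p` and `λ₁(p) ≤ λ₁(r) ≤ ⋯ ≤ λₙ₋₁(r) ≤ λₙ(p)`. -/
def Interlaces (p r : ℝ[X]) : Prop :=
  p ∈ polysWithZerosIn p.natDegree Set.univ ∧ r ∈ polysWithZerosIn r.natDegree Set.univ ∧
  (r.natDegree = p.natDegree ∨ r.natDegree + 1 = p.natDegree) ∧
  (∀ k < r.natDegree, zeroAt p k ≤ zeroAt r k) ∧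
  (∀ k < r.natDegree, k + 1 < p.natDegree → zeroAt r k ≤ zeroAt p (k + 1))

end

/-! ### The recurrence satisfied by the `q`-Bessel polynomials -/

/-! The engine is y_{n+1}(qx;b) = (1-x) y_n(x;bq²) + bqx y_n(qx;bq²). Let m_0 < ... < m_{n-1} be the
zeros of y_n(·;bq²), with m_n = 1 appended and all consecutive ratios below q. At x = m_j the first
term vanishes, at x = m_{j-1}/q the second does, and the surviving terms have opposite signs because
b < 0. So y_{n+1}(·;b) has a zero l_j in (m_{j-1}, q m_j), and l_j < q m_j < q l_{j+1} carries the
mesh bound through the induction (`IsZeroSeq.exists_succ`).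

For monotonicity, the recurrence at a zero qx reads ∏ (1-x/m_i)/(1-qx/m_i) · (1-x) = -bqx.
Increasing x or decreasing the m_i lowers the left side, while increasing x or -b raises the right
side. Hence zeros decrease when b decreases, and also when the degree grows (`IsZeroSeq.le_of_le`).
The degree comparison supplies the second half of the interlacing, via y_{n-1}(·;bq²). -/

theorem qPoch_succ (a q : ℝ) (k : ℕ) : qPoch a q (k + 1) = qPoch a q k * (1 - a * q ^ k) :=
  Finset.prod_range_succ _ _

theorem qPoch_succ' (a q : ℝ) (k : ℕ) : qPoch a q (k + 1) = (1 - a) * qPoch (a * q) q k := by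
  simp only [qPoch, Finset.prod_range_succ', pow_zero, mul_one]
  rw [mul_comm]
  congr 1
  refine Finset.prod_congr rfl fun j _ => ?_
  ring

theorem qPoch_zero_left (q : ℝ) (k : ℕ) : qPoch 0 q k = 1 := by simp [qPoch]

theorem qPoch_self_ne_zero {q : ℝ} (hq0 : 0 < q) (hq1 : q < 1) (k : ℕ) : qPoch q q k ≠ 0 := by
  refine Finset.prod_ne_zero_iff.2 fun j _ => ?_
  rw [← pow_succ']
  exact sub_ne_zero.2 (pow_lt_one₀ hq0.le hq1 j.succ_ne_zero).ne'

theorem qPoch_inv_pow_eq_zero {q : ℝ} (hq : q ≠ 0) {n k : ℕ} (h : n < k) :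
    qPoch (q ^ (-(n : ℤ))) q k = 0 := by
  refine Finset.prod_eq_zero (Finset.mem_range.2 h) ?_
  rw [zpow_neg, zpow_natCast, inv_mul_cancel₀ (pow_ne_zero n hq), sub_self]

theorem coeff_qBessel {q : ℝ} (hq : q ≠ 0) (n : ℕ) (b : ℝ) (k : ℕ) :
    (qBessel q n b).coeff k =
      qPoch (q ^ (-(n : ℤ))) q k * qPoch (b * q ^ n) q k / qPoch q q k := by
  have hc : ∀ k, qHypCoeff [q ^ (-(n : ℤ)), b * q ^ n] [0] q k =
      qPoch (q ^ (-(n : ℤ))) q k * qPoch (b * q ^ n) q k / qPoch q q k := by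
    intro k
    simp [qHypCoeff, qPoch_zero_left]
  simp only [qBessel, qHypPoly, finsetSum_coeff, coeff_C_mul, coeff_X_pow, hc, mul_ite, mul_one,
    mul_zero, Finset.sum_ite_eq, Finset.mem_range]
  split_ifs with h
  · rfl
  · rw [qPoch_inv_pow_eq_zero hq (by omega)]; simp

theorem natDegree_qBessel_le (q : ℝ) (n : ℕ) (b : ℝ) : (qBessel q n b).natDegree ≤ n := by
  rw [qBessel, qHypPoly]
  refine natDegree_sum_le_of_forall_le _ _ fun k hk => ?_
  exact (natDegree_C_mul_X_pow_le _ _).trans (Nat.lt_succ_iff.1 (Finset.mem_range.1 hk))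

theorem qBessel_eval_zero {q : ℝ} (hq : q ≠ 0) (n : ℕ) (b : ℝ) :
    (qBessel q n b).eval 0 = 1 := by
  rw [← coeff_zero_eq_eval_zero, coeff_qBessel hq]
  simp [qPoch]

theorem qBessel_zero (q b : ℝ) : qBessel q 0 b = 1 := by
  simp [qBessel, qHypPoly, qHypCoeff, qPoch]

theorem qBesselDilated_succ {q : ℝ} (hq0 : 0 < q) (hq1 : q < 1) (n : ℕ) (b : ℝ) :
    qBesselDilated q (n + 1) b = (1 - X) * qBessel q n (b * q ^ 2) +
      C (b * q) * X * qBesselDilated q n (b * q ^ 2) := by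
  have hq := hq0.ne'
  ext k
  rw [qBesselDilated, qBesselDilated, sub_mul, one_mul, mul_assoc (C (b * q))]
  cases k with
  | zero => simp [comp_C_mul_X_coeff, coeff_qBessel hq, qPoch]
  | succ k =>
    simp only [coeff_add, coeff_sub, coeff_C_mul, coeff_X_mul, comp_C_mul_X_coeff,
      coeff_qBessel hq]
    have h1 := qPoch_self_ne_zero hq0 hq1 k
    have h2 := qPoch_self_ne_zero hq0 hq1 (k + 1)
    have e1 : q ^ (-((n + 1 : ℕ) : ℤ)) * q = q ^ (-(n : ℤ)) := by
      rw [← zpow_add_one₀ hq]; congr 1; push_cast; ring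
    have e2 : q ^ (-((n + 1 : ℕ) : ℤ)) = (q ^ n * q)⁻¹ := by
      rw [zpow_neg, zpow_natCast, pow_succ]
    have e3 : b * q ^ (n + 1) * q = b * q ^ 2 * q ^ n := by ring
    rw [qPoch_succ' (q ^ (-((n + 1 : ℕ) : ℤ))), e1, qPoch_succ' (b * q ^ (n + 1)), e3,
      qPoch_succ (q ^ (-(n : ℤ))), qPoch_succ (b * q ^ 2 * q ^ n), e2]
    rw [qPoch_succ] at h2 ⊢
    have h3 := right_ne_zero_of_mul h2
    have e4 : q ^ (-(n : ℤ)) = (q ^ n)⁻¹ := by rw [zpow_neg, zpow_natCast]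
    -- All terms now share the same Pochhammer factors; treating these and the powers of `q` as free
    -- variables leaves a rational identity.
    generalize qPoch (q ^ (-(n : ℤ))) q k = P
    rw [e4]
    generalize qPoch (b * q ^ 2 * q ^ n) q k = Q
    generalize qPoch q q k = R at *
    have h5 : q ^ n ≠ 0 := pow_ne_zero n hq
    simp only [pow_succ, pow_zero] at *
    generalize q ^ n = u at *
    generalize q ^ k = v at *
    field_simp
    ring

theorem qBessel_eval_mul {q : ℝ} (hq0 : 0 < q) (hq1 : q < 1) (n : ℕ) (b x : ℝ) :
    (qBessel q (n + 1) b).eval (q * x) = (1 - x) * (qBessel q n (b * q ^ 2)).eval x +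
      b * q * x * (qBessel q n (b * q ^ 2)).eval (q * x) := by
  have h := congrArg (eval x) (qBesselDilated_succ hq0 hq1 n b)
  simpa [qBesselDilated] using h

noncomputable section

/-! ### Polynomials with prescribed simple positive zeros -/

/-- The polynomial with zeros `l 0, …, l (n - 1)` and constant coefficient `1`. -/
def zeroPoly (n : ℕ) (l : ℕ → ℝ) : ℝ[X] := ∏ j ∈ Finset.range n, (1 - C (l j)⁻¹ * X)

theorem eval_zeroPoly (n : ℕ) (l : ℕ → ℝ) (x : ℝ) :
    (zeroPoly n l).eval x = ∏ j ∈ Finset.range n, (1 - x / l j) := by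
  simp only [zeroPoly, eval_prod, eval_sub, eval_one, eval_mul, eval_C, eval_X]
  exact Finset.prod_congr rfl fun j _ => by ring

theorem zeroPoly_comp (n : ℕ) (l : ℕ → ℝ) (q : ℝ) :
    (zeroPoly n l).comp (C q * X) = zeroPoly n fun j => l j / q := by
  rw [zeroPoly, zeroPoly, prod_comp]
  refine Finset.prod_congr rfl fun j _ => ?_
  rw [inv_div, div_eq_mul_inv, C_mul]
  simp only [sub_comp, one_comp, mul_comp, C_comp, X_comp]
  ring

section

variable {l : ℕ → ℝ}

theorem pos_of_strictMono (h0 : 0 < l 0) (hl : StrictMono l) (j : ℕ) : 0 < l j :=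
  h0.trans_le (hl.monotone j.zero_le)

theorem zeroPoly_eq_C_mul (h0 : 0 < l 0) (hl : StrictMono l) (n : ℕ) :
    zeroPoly n l = C (∏ j ∈ Finset.range n, -(l j)⁻¹) *
      (((Multiset.range n).map l).map fun a => X - C a).prod := by
  have : (((Multiset.range n).map l).map fun a => X - C a).prod =
      ∏ j ∈ Finset.range n, (X - C (l j)) := by
    rw [Multiset.map_map]; rfl
  rw [this, zeroPoly, map_prod, ← Finset.prod_mul_distrib]
  refine Finset.prod_congr rfl fun j _ => ?_
  rw [mul_sub, ← C_mul, neg_mul (l j)⁻¹, inv_mul_cancel₀ (pos_of_strictMono h0 hl j).ne']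
  simp
  ring

theorem prod_neg_inv_ne_zero (h0 : 0 < l 0) (hl : StrictMono l) (n : ℕ) :
    ∏ j ∈ Finset.range n, -(l j)⁻¹ ≠ 0 :=
  Finset.prod_ne_zero_iff.2 fun j _ =>
    neg_ne_zero.2 (inv_ne_zero (pos_of_strictMono h0 hl j).ne')

theorem natDegree_zeroPoly (h0 : 0 < l 0) (hl : StrictMono l) (n : ℕ) :
    (zeroPoly n l).natDegree = n := by
  rw [zeroPoly_eq_C_mul h0 hl, natDegree_C_mul (prod_neg_inv_ne_zero h0 hl n),
    natDegree_multiset_prod_X_sub_C_eq_card]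
  simp

theorem roots_zeroPoly (h0 : 0 < l 0) (hl : StrictMono l) (n : ℕ) :
    (zeroPoly n l).roots = (Multiset.range n).map l := by
  rw [zeroPoly_eq_C_mul h0 hl, roots_C_mul _ (prod_neg_inv_ne_zero h0 hl n),
    roots_multiset_prod_X_sub_C]

theorem zeroAt_zeroPoly (h0 : 0 < l 0) (hl : StrictMono l) {n j : ℕ} (hj : j < n) :
    zeroAt (zeroPoly n l) j = l j := by
  have h : ((Multiset.range n).map l).sort (· ≤ ·) = (List.range n).map l := by
    rw [← Multiset.map_sort l (Multiset.range n) (· ≤ ·) (· ≤ ·)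
      fun a _ b _ => hl.le_iff_le.symm, Multiset.sort_range]
  rw [zeroAt, roots_zeroPoly h0 hl, h]
  simp [List.getD, hj]

theorem zeroPoly_mem_polysWithZerosIn (h0 : 0 < l 0) (hl : StrictMono l) {n : ℕ} {K : Set ℝ}
    (hK : ∀ j < n, l j ∈ K) : zeroPoly n l ∈ polysWithZerosIn n K := by
  refine ⟨(natDegree_zeroPoly h0 hl n).le, fun z hz => ?_⟩
  rw [zeroPoly, map_prod, Finset.prod_eq_zero_iff] at hz
  obtain ⟨j, hj, hz⟩ := hz
  refine ⟨l j, hK j (Finset.mem_range.1 hj), ?_⟩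
  have hne : (l j : ℂ) ≠ 0 := by exact_mod_cast (pos_of_strictMono h0 hl j).ne'
  simp only [map_sub, map_one, map_mul, aeval_C, aeval_X, Complex.coe_algebraMap,
    Complex.ofReal_inv] at hz
  exact ((inv_mul_eq_one₀ hne).1 (sub_eq_zero.1 hz).symm)

theorem lmesh_zeroPoly_lt (h0 : 0 < l 0) (hl : StrictMono l) {n : ℕ} {q : ℝ} (hq : 0 < q)
    (hm : ∀ j, j + 1 < n → l j < q * l (j + 1)) : lmesh (zeroPoly n l) < q := by
  rw [lmesh]
  have hd := natDegree_zeroPoly h0 hl n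
  rcases isEmpty_or_nonempty (Fin ((zeroPoly n l).natDegree - 1)) with h | h
  · rwa [Real.iSup_of_isEmpty]
  · obtain ⟨j, hj⟩ := exists_eq_ciSup_of_finite
      (f := fun j : Fin ((zeroPoly n l).natDegree - 1) =>
        zeroAt (zeroPoly n l) j / zeroAt (zeroPoly n l) ((j : ℕ) + 1))
    have hj' : (j : ℕ) + 1 < n := by omega
    rw [← hj, zeroAt_zeroPoly h0 hl (by omega), zeroAt_zeroPoly h0 hl hj',
      div_lt_iff₀ (pos_of_strictMono h0 hl _)]
    exact hm j hj'

theorem interlaces_zeroPoly {m : ℕ → ℝ} (h0 : 0 < l 0) (hl : StrictMono l) (h0' : 0 < m 0)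
    (hm : StrictMono m) {n : ℕ} (h1 : ∀ j < n, l j ≤ m j) (h2 : ∀ j, j + 1 < n → m j ≤ l (j + 1)) :
    Interlaces (zeroPoly n l) (zeroPoly n m) := by
  have hd := natDegree_zeroPoly h0 hl n
  have hd' := natDegree_zeroPoly h0' hm n
  rw [Interlaces, hd, hd']
  refine ⟨zeroPoly_mem_polysWithZerosIn h0 hl fun _ _ => trivial,
    zeroPoly_mem_polysWithZerosIn h0' hm fun _ _ => trivial, Or.inl rfl, fun j hj => ?_,
    fun j hj hj' => ?_⟩
  · rw [zeroAt_zeroPoly h0 hl hj, zeroAt_zeroPoly h0' hm hj]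
    exact h1 j hj
  · rw [zeroAt_zeroPoly h0 hl hj', zeroAt_zeroPoly h0' hm hj]
    exact h2 j hj'

/-- A polynomial of degree at most `n` with constant coefficient `1` is determined by `n` distinct
positive zeros. -/
theorem eq_zeroPoly_of_eval_eq_zero (h0 : 0 < l 0) (hl : StrictMono l) {n : ℕ} {p : ℝ[X]}
    (hd : p.natDegree ≤ n) (hp : p.eval 0 = 1) (hz : ∀ j < n, p.eval (l j) = 0) :
    p = zeroPoly n l := by
  have hpos := pos_of_strictMono h0 hl
  -- The `n + 1` interpolation nodes are 0 and the `n` prescribed zeros.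
  set v : ℕ → ℝ := fun j => if j = 0 then 0 else l (j - 1) with hv
  have hinj : Function.Injective v := by
    intro i j hij
    rcases i with _ | i <;> rcases j with _ | j
    · rfl
    · exact absurd hij (hpos j).ne
    · exact absurd hij (hpos i).ne'
    · exact congrArg (· + 1) (hl.injective hij)
  refine eq_of_degrees_lt_of_eval_index_eq (Finset.range (n + 1)) (v := v) hinj.injOn
    ?_ ?_ fun j hj => ?_
  · rw [Finset.card_range]
    exact (natDegree_le_iff_degree_le.1 hd).trans_lt (by exact_mod_cast n.lt_succ_self)
  · rw [Finset.card_range]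
    exact (natDegree_le_iff_degree_le.1 (natDegree_zeroPoly h0 hl n).le).trans_lt
      (by exact_mod_cast n.lt_succ_self)
  · rcases j with _ | j
    · simp [hv, hp, eval_zeroPoly]
    · have hj : j < n := by simpa using hj
      simp only [hv, Nat.add_one_ne_zero, if_false, Nat.add_sub_cancel]
      rw [hz j hj, eval_zeroPoly, eq_comm]
      exact Finset.prod_eq_zero (Finset.mem_range.2 hj) (by rw [div_self (hpos j).ne', sub_self])

/-- Exactly the first `i` factors `1 - x / l j` are negative. -/
theorem eval_zeroPoly_sign (h0 : 0 < l 0) (hl : StrictMono l) {n i : ℕ} {x : ℝ} (hi : i ≤ n)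
    (h1 : ∀ j < i, l j < x) (h2 : i < n → x < l i) : 0 < (-1) ^ i * (zeroPoly n l).eval x := by
  have hpos := pos_of_strictMono h0 hl
  rw [eval_zeroPoly, ← Finset.prod_range_mul_prod_Ico _ hi, ← mul_assoc]
  refine mul_pos ?_ (Finset.prod_pos fun j hj => ?_)
  · have : (-1 : ℝ) ^ i = ∏ j ∈ Finset.range i, (-1 : ℝ) := by simp
    rw [this, ← Finset.prod_mul_distrib]
    refine Finset.prod_pos fun j hj => ?_
    have := (one_lt_div (hpos j)).2 (h1 j (Finset.mem_range.1 hj))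
    linarith
  · rw [Finset.mem_Ico] at hj
    have hx := (h2 (hj.1.trans_lt hj.2)).trans_le (hl.monotone hj.1)
    have := (div_lt_one (hpos j)).2 hx
    linarith

end

end

noncomputable section

/-! ### The zeros of the `q`-Bessel polynomials -/

/-- The sequence `l` starts with the `n` zeros of `qBessel q n b`, continues with `1`, and is
positive with consecutive ratios less than `q`. -/
structure IsZeroSeq (q : ℝ) (n : ℕ) (b : ℝ) (l : ℕ → ℝ) : Prop where
  pos_zero : 0 < l 0
  lt_mul : ∀ j, l j < q * l (j + 1)
  eq_one : l n = 1
  eq_zeroPoly : qBessel q n b = zeroPoly n l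

variable {q : ℝ}

theorem pos_of_lt_mul {l : ℕ → ℝ} (hq0 : 0 < q) (h0 : 0 < l 0) (h : ∀ j, l j < q * l (j + 1))
    (j : ℕ) : 0 < l j := by
  induction j with
  | zero => exact h0
  | succ j ih => exact pos_of_mul_pos_right (ih.trans (h j)) hq0.le

theorem strictMono_of_lt_mul {l : ℕ → ℝ} (hq0 : 0 < q) (hq1 : q < 1) (h0 : 0 < l 0)
    (h : ∀ j, l j < q * l (j + 1)) : StrictMono l :=
  strictMono_nat_of_lt_succ fun j =>
    (h j).trans (mul_lt_of_lt_one_left (pos_of_lt_mul hq0 h0 h _) hq1)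

theorem IsZeroSeq.strictMono {n : ℕ} {b : ℝ} {l : ℕ → ℝ} (h : IsZeroSeq q n b l) (hq0 : 0 < q)
    (hq1 : q < 1) : StrictMono l :=
  strictMono_of_lt_mul hq0 hq1 h.pos_zero h.lt_mul

theorem IsZeroSeq.unique {n : ℕ} {b : ℝ} {l m : ℕ → ℝ} (hq0 : 0 < q) (hq1 : q < 1)
    (hl : IsZeroSeq q n b l) (hm : IsZeroSeq q n b m) {j : ℕ} (hj : j < n) : l j = m j := by
  rw [← zeroAt_zeroPoly hl.pos_zero (hl.strictMono hq0 hq1) hj,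
    ← zeroAt_zeroPoly hm.pos_zero (hm.strictMono hq0 hq1) hj, ← hl.eq_zeroPoly, ← hm.eq_zeroPoly]

/-- There are no zeros in degree 0, so only the tail matters: it starts at 1 and has ratios `q / 2 <
q`. -/
theorem isZeroSeq_zero (hq0 : 0 < q) (b : ℝ) : IsZeroSeq q 0 b fun j => (2 / q) ^ j where
  pos_zero := by simp
  lt_mul j := by
    have : 0 < (2 / q) ^ j := by positivity
    rw [pow_succ]
    field_simp
    linarith
  eq_one := by simp
  eq_zeroPoly := by simp [qBessel_zero, zeroPoly]

/-! ### Existence and location of the zeros -/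

theorem IsZeroSeq.exists_zero_between {n : ℕ} {b : ℝ} {m : ℕ → ℝ} (hq0 : 0 < q) (hq1 : q < 1)
    (hb : b < 0) (hm : IsZeroSeq q n (b * q ^ 2) m) {j : ℕ} (hj : j ≤ n) :
    ∃ x, 0 < x ∧ (∀ i < j, m i < q * x) ∧ x < m j ∧ (qBessel q (n + 1) b).eval (q * x) = 0 := by
  have hmono := hm.strictMono hq0 hq1
  have hpos := pos_of_strictMono hm.pos_zero hmono
  -- Since `m n = 1`, the factor `1 - x` is the last factor of `zeroPoly (n + 1) m`.
  have hp : ∀ x, (qBessel q (n + 1) b).eval (q * x) = (zeroPoly (n + 1) m).eval x +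
      b * q * x * (zeroPoly n m).eval (q * x) := by
    intro x
    rw [qBessel_eval_mul hq0 hq1, hm.eq_zeroPoly, eval_zeroPoly (n + 1), Finset.prod_range_succ,
      hm.eq_one, eval_zeroPoly n m x]
    ring
  have hzero : ∀ {k i : ℕ}, i < k → (zeroPoly k m).eval (m i) = 0 := by
    intro k i hi
    rw [eval_zeroPoly]
    exact Finset.prod_eq_zero (Finset.mem_range.2 hi) (by rw [div_self (hpos i).ne', sub_self])
  have hright : (-1) ^ j * (qBessel q (n + 1) b).eval (q * m j) < 0 := by
    have hs := eval_zeroPoly_sign hm.pos_zero hmono (x := q * m j) hj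
      (fun i hi => (hm.lt_mul i).trans_le
        (mul_le_mul_of_nonneg_left (hmono.monotone hi) hq0.le))
      fun _ => mul_lt_of_lt_one_left (hpos j) hq1
    rw [hp, hzero (Nat.lt_succ_of_le hj)]
    have : 0 < -(b * q * m j) := by
      have := mul_pos (mul_pos (neg_pos.2 hb) hq0) (hpos j)
      linarith
    have := mul_pos this hs
    linarith
  -- The left endpoint is the previous zero divided by `q`; for `j = 0` it is 0, where the
  -- polynomial equals 1.
  obtain ⟨a, ha0, ha, haj, hleft⟩ : ∃ a, 0 ≤ a ∧ (∀ i < j, m i ≤ q * a) ∧ a < m j ∧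
      0 < (-1) ^ j * (qBessel q (n + 1) b).eval (q * a) := by
    rcases j with _ | j
    · exact ⟨0, le_rfl, by simp, hpos 0, by simp [qBessel_eval_zero hq0.ne']⟩
    · have hqa : q * (m j / q) = m j := mul_div_cancel₀ _ hq0.ne'
      have hlt : m j / q < m (j + 1) := (div_lt_iff₀' hq0).2 (hm.lt_mul j)
      refine ⟨m j / q, (div_pos (hpos j) hq0).le, fun i hi => ?_, hlt, ?_⟩
      · rw [hqa]
        exact hmono.monotone (Nat.lt_succ_iff.1 hi)
      · rw [hp, hqa, hzero (Nat.lt_of_succ_le hj), mul_zero, add_zero]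
        refine eval_zeroPoly_sign hm.pos_zero hmono (hj.trans n.le_succ) (fun i hi => ?_)
          fun _ => hlt
        exact (hmono.monotone (Nat.lt_succ_iff.1 hi)).trans_lt
          ((lt_div_iff₀ hq0).2 (mul_lt_of_lt_one_right (hpos j) hq1))
  have hcont : ContinuousOn (fun x => (-1) ^ j * (qBessel q (n + 1) b).eval (q * x))
      (Set.Icc a (m j)) := by fun_prop
  obtain ⟨x, ⟨hax, hxm⟩, hx⟩ := intermediate_value_Ioo' haj.le hcont ⟨hright, hleft⟩
  refine ⟨x, ha0.trans_lt hax, fun i hi => ?_, hxm, ?_⟩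
  · exact (ha i hi).trans_lt (mul_lt_mul_of_pos_left hax hq0)
  · exact (mul_eq_zero.1 hx).resolve_left (pow_ne_zero _ (by norm_num))

theorem IsZeroSeq.exists_succ {n : ℕ} {b : ℝ} {m : ℕ → ℝ} (hq0 : 0 < q) (hq1 : q < 1)
    (hb : b < 0) (hm : IsZeroSeq q n (b * q ^ 2) m) :
    ∃ l, IsZeroSeq q (n + 1) b l ∧ (∀ j ≤ n, l j < q * m j) ∧
      ∀ i j, i < j → j ≤ n → m i < l j := by
  have hex : ∀ j, ∃ x, j ≤ n → 0 < x ∧ (∀ i < j, m i < q * x) ∧ x < m j ∧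
      (qBessel q (n + 1) b).eval (q * x) = 0 := by
    intro j
    by_cases hj : j ≤ n
    · obtain ⟨x, hx⟩ := hm.exists_zero_between hq0 hq1 hb hj
      exact ⟨x, fun _ => hx⟩
    · exact ⟨0, fun h => absurd h hj⟩
  choose x hx using hex
  -- Beyond the `n + 1` zeros the sequence is padded with powers of `2 / q`, the first being the
  -- required 1.
  set l : ℕ → ℝ := fun j => if j ≤ n then q * x j else (2 / q) ^ (j - (n + 1)) with hl
  have hle : ∀ {j}, j ≤ n → l j = q * x j := fun h => if_pos h
  have hgt : ∀ k, l (n + 1 + k) = (2 / q) ^ k := fun k => by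
    simp only [hl]
    rw [if_neg (by omega), Nat.add_sub_cancel_left]
  have h0 : 0 < l 0 := by
    rw [hle n.zero_le]
    exact mul_pos hq0 (hx 0 n.zero_le).1
  have hone : l (n + 1) = 1 := by simpa using hgt 0
  have hlt : ∀ j, l j < q * l (j + 1) := by
    intro j
    rcases lt_trichotomy j n with h | rfl | h
    · rw [hle h.le, hle h]
      have h1 := (hx j h.le).2.2.1
      have h2 := (hx (j + 1) h).2.1 j j.lt_succ_self
      exact mul_lt_mul_of_pos_left (h1.trans h2) hq0
    · rw [hle le_rfl, hone]
      have h1 := (hx j le_rfl).2.2.1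
      rw [hm.eq_one] at h1
      exact mul_lt_mul_of_pos_left h1 hq0
    · obtain ⟨k, rfl⟩ := Nat.exists_eq_add_of_lt h
      have e : n + k + 1 = n + 1 + k := by omega
      rw [e, hgt, add_assoc (n + 1), hgt]
      exact (isZeroSeq_zero hq0 b).lt_mul k
  refine ⟨l, ⟨h0, hlt, hone, ?_⟩, fun j hj => ?_, fun i j hij hj => ?_⟩
  · refine eq_zeroPoly_of_eval_eq_zero h0 (strictMono_of_lt_mul hq0 hq1 h0 hlt) (natDegree_qBessel_le _ _ _)
      (qBessel_eval_zero hq0.ne' _ _) fun j hj => ?_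
    rw [hle (Nat.lt_succ_iff.1 hj)]
    exact (hx j (Nat.lt_succ_iff.1 hj)).2.2.2
  · rw [hle hj]
    exact mul_lt_mul_of_pos_left (hx j hj).2.2.1 hq0
  · rw [hle hj]
    exact (hx j hj).2.1 i hij

theorem exists_isZeroSeq (hq0 : 0 < q) (hq1 : q < 1) (n : ℕ) {b : ℝ} (hb : b < 0) :
    ∃ l, IsZeroSeq q n b l := by
  induction n generalizing b with
  | zero => exact ⟨_, isZeroSeq_zero hq0 b⟩
  | succ n ih =>
    obtain ⟨m, hm⟩ := ih (mul_neg_of_neg_of_pos hb (pow_pos hq0 2))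
    obtain ⟨l, hl, -⟩ := hm.exists_succ hq0 hq1 hb
    exact ⟨l, hl⟩

/-- The zeros of `qBessel q n (b * q ^ 2)` and those of `qBessel q (n + 1) b`, divided by `q`,
interlace. -/
theorem IsZeroSeq.interlace {n : ℕ} {b : ℝ} {l m : ℕ → ℝ} (hq0 : 0 < q) (hq1 : q < 1)
    (hb : b < 0) (hl : IsZeroSeq q (n + 1) b l) (hm : IsZeroSeq q n (b * q ^ 2) m) :
    (∀ j ≤ n, l j < q * m j) ∧ ∀ i j, i < j → j ≤ n → m i < l j := by
  obtain ⟨l', hl', h1, h2⟩ := hm.exists_succ hq0 hq1 hb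
  refine ⟨fun j hj => ?_, fun i j hij hj => ?_⟩
  · rw [hl.unique hq0 hq1 hl' (Nat.lt_succ_of_le hj)]
    exact h1 j hj
  · rw [hl.unique hq0 hq1 hl' (Nat.lt_succ_of_le hj)]
    exact h2 i j hij hj

/-! ### Monotonicity of the zeros in the degree and the parameter -/

/-- The map u ↦ (1-u)/(1-qu) is positive off [1, 1/q] and decreasing on each side; the cross
products differ by (1-q)(v-u). -/
theorem ratio_pos_and_anti (hq0 : 0 < q) (hq1 : q < 1) {u v : ℝ} (huv : u ≤ v)
    (h : v < 1 ∨ 1 < q * u) :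
    0 < (1 - v) / (1 - q * v) ∧ (1 - v) / (1 - q * v) ≤ (1 - u) / (1 - q * u) := by
  have hquv : q * u ≤ q * v := mul_le_mul_of_nonneg_left huv hq0.le
  have key : 0 ≤ (1 - q) * (v - u) := mul_nonneg (by linarith) (by linarith)
  rcases h with h | h
  · have h1 : 0 < 1 - q * v := by nlinarith
    have h2 : 0 < 1 - q * u := by linarith
    refine ⟨div_pos (by linarith) h1, ?_⟩
    rw [div_le_div_iff₀ h1 h2]
    linarith
  · have hu : 1 < u := by nlinarith
    have h1 : 0 < q * v - 1 := by linarith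
    have h2 : 0 < q * u - 1 := by linarith
    rw [← neg_div_neg_eq (1 - v), ← neg_div_neg_eq (1 - u), neg_sub, neg_sub, neg_sub, neg_sub]
    refine ⟨div_pos (by linarith) h1, ?_⟩
    rw [div_le_div_iff₀ h1 h2]
    linarith

theorem IsZeroSeq.prod_ratio_eq {n : ℕ} {b : ℝ} {l m : ℕ → ℝ} (hq0 : 0 < q) (hq1 : q < 1)
    (hb : b < 0) (hl : IsZeroSeq q (n + 1) b l) (hm : IsZeroSeq q n (b * q ^ 2) m)
    {j : ℕ} (hj : j ≤ n) {x : ℝ} (hx : q * x = l j) :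
    (∏ i ∈ Finset.range n, (1 - x / m i) / (1 - q * (x / m i))) * (1 - x) = -b * q * x := by
  have hmono := hm.strictMono hq0 hq1
  have hpos := pos_of_strictMono hm.pos_zero hmono
  have h := qBessel_eval_mul hq0 hq1 n b x
  have hz : (qBessel q (n + 1) b).eval (q * x) = 0 := by
    rw [hl.eq_zeroPoly, eval_zeroPoly, hx]
    refine Finset.prod_eq_zero (Finset.mem_range.2 (Nat.lt_succ_of_le hj)) ?_
    rw [div_self (pos_of_strictMono hl.pos_zero (hl.strictMono hq0 hq1) j).ne', sub_self]
  rw [hz, hm.eq_zeroPoly, eval_zeroPoly, eval_zeroPoly] at h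
  -- By interlacing, `l j` lies strictly between `m (j - 1)` and `m j`, so no denominator vanishes.
  have hne : ∏ i ∈ Finset.range n, (1 - q * (x / m i)) ≠ 0 := by
    refine Finset.prod_ne_zero_iff.2 fun i _ => ?_
    rw [← mul_div_assoc, hx, sub_ne_zero, ne_comm, Ne, div_eq_one_iff_eq (hpos i).ne']
    obtain ⟨h1, h2⟩ := hl.interlace hq0 hq1 hb hm
    rcases lt_or_ge i j with hij | hij
    · exact (h2 i j hij hj).ne'
    · exact (((h1 j hj).trans (mul_lt_of_lt_one_left (hpos j) hq1)).trans_le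
        (hmono.monotone hij)).ne
  simp only [mul_div_assoc] at h
  rw [Finset.prod_div_distrib, div_mul_eq_mul_div, div_eq_iff hne]
  linarith

/-- The zeros decrease as the degree grows and as the parameter decreases. -/
theorem IsZeroSeq.le_of_le (hq0 : 0 < q) (hq1 : q < 1) {n n' : ℕ} {b b' : ℝ} {l l' : ℕ → ℝ}
    (hn : n ≤ n') (hbb : b' ≤ b) (hb : b < 0) (hl : IsZeroSeq q n b l)
    (hl' : IsZeroSeq q n' b' l') {j : ℕ} (hj : j < n) : l' j ≤ l j := by
  induction n generalizing n' b b' l l' j with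
  | zero => exact absurd hj j.not_lt_zero
  | succ n ih =>
    obtain ⟨k, rfl⟩ : ∃ k, n' = k + 1 := ⟨n' - 1, by omega⟩
    have hj : j ≤ n := Nat.lt_succ_iff.1 hj
    have hn : n ≤ k := Nat.succ_le_succ_iff.1 hn
    have hb' : b' < 0 := hbb.trans_lt hb
    have hq2 := pow_pos hq0 2
    have hbq : b * q ^ 2 < 0 := mul_neg_of_neg_of_pos hb hq2
    obtain ⟨m, hm⟩ := exists_isZeroSeq hq0 hq1 n hbq
    obtain ⟨m', hm'⟩ := exists_isZeroSeq hq0 hq1 k (mul_neg_of_neg_of_pos hb' hq2)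
    have hmono := hm.strictMono hq0 hq1
    have hmono' := hm'.strictMono hq0 hq1
    have hpos := pos_of_strictMono hm.pos_zero hmono
    have hpos' := pos_of_strictMono hm'.pos_zero hmono'
    have hmm : ∀ i ≤ n, m' i ≤ m i := by
      intro i hi
      rcases hi.lt_or_eq with hi | rfl
      · exact ih hn (mul_le_mul_of_nonneg_right hbb hq2.le) hbq hm hm' hi
      · rw [hm.eq_one, ← hm'.eq_one]
        exact hmono'.monotone hn
    obtain ⟨-, hml⟩ := hl.interlace hq0 hq1 hb hm
    obtain ⟨hlm', -⟩ := hl'.interlace hq0 hq1 hb' hm'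
    by_contra! hlt
    obtain ⟨x, hx⟩ : ∃ x, q * x = l j := ⟨l j / q, mul_div_cancel₀ _ hq0.ne'⟩
    obtain ⟨x', hx'⟩ : ∃ x', q * x' = l' j := ⟨l' j / q, mul_div_cancel₀ _ hq0.ne'⟩
    have hxx : x < x' := lt_of_mul_lt_mul_left (by rwa [hx, hx']) hq0.le
    have hx0 : 0 < x := pos_of_mul_pos_right
      (by rw [hx]; exact pos_of_strictMono hl.pos_zero (hl.strictMono hq0 hq1) j) hq0.le
    have hxm' : x' < m' j := lt_of_mul_lt_mul_left (by rw [hx']; exact hlm' j (hj.trans hn)) hq0.le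
    have hx1 : x' < 1 := by
      rw [← hm'.eq_one]
      exact hxm'.trans_le (hmono'.monotone (hj.trans hn))
    have e := hl.prod_ratio_eq hq0 hq1 hb hm hj hx
    have e' := hl'.prod_ratio_eq hq0 hq1 hb' hm' (hj.trans hn) hx'
    have hlt1 : ∀ i, j ≤ i → x' / m' i < 1 := fun i hi =>
      (div_lt_one (hpos' i)).2 (hxm'.trans_le (hmono'.monotone hi))
    have hfac : ∀ i ∈ Finset.range n, 0 < (1 - x' / m' i) / (1 - q * (x' / m' i)) ∧
        (1 - x' / m' i) / (1 - q * (x' / m' i)) ≤ (1 - x / m i) / (1 - q * (x / m i)) := by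
      intro i hi
      have hi := Finset.mem_range.1 hi
      refine ratio_pos_and_anti hq0 hq1
        (div_le_div₀ (hx0.trans hxx).le hxx.le (hpos' i) (hmm i hi.le)) ?_
      -- Interlacing puts both arguments beyond `1 / q` for `i < j` and below 1 for `i ≥ j`, so the
      -- pole is never crossed.
      rcases lt_or_ge i j with hij | hij
      · right
        rw [← mul_div_assoc, hx, one_lt_div (hpos i)]
        exact hml i j hij hj
      · exact Or.inl (hlt1 i hij)
    -- The extra factors of the higher degree are at most 1: compare with argument 0.
    have hfac' : ∀ i ∈ Finset.Ico n k, 0 < (1 - x' / m' i) / (1 - q * (x' / m' i)) ∧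
        (1 - x' / m' i) / (1 - q * (x' / m' i)) ≤ 1 := by
      intro i hi
      have := ratio_pos_and_anti hq0 hq1 (div_pos (hx0.trans hxx) (hpos' i)).le
        (Or.inl (hlt1 i (hj.trans (Finset.mem_Ico.1 hi).1)))
      simpa using this
    have hprod := Finset.prod_le_prod (fun i hi => (hfac i hi).1.le) fun i hi => (hfac i hi).2
    have hprod0 := Finset.prod_nonneg fun i hi => (hfac i hi).1.le
    have hprod' := Finset.prod_le_one (fun i hi => (hfac' i hi).1.le) fun i hi => (hfac' i hi).2
    rw [← Finset.prod_range_mul_prod_Ico _ hn] at e'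
    have h1 : -b' * q * x' ≤ -b * q * x := by
      rw [← e, ← e']
      refine mul_le_mul ((mul_le_of_le_one_right hprod0 hprod').trans hprod) (by linarith)
        (by linarith) (hprod0.trans hprod)
    have h2 : -b * q * x < -b' * q * x' := by
      have hbq : 0 < -b * q := mul_pos (neg_pos.2 hb) hq0
      have hbq' : -b * q ≤ -b' * q := mul_le_mul_of_nonneg_right (neg_le_neg hbb) hq0.le
      exact mul_lt_mul' hbq' hxx hx0.le (hbq.trans_le hbq')
    exact absurd h1 h2.not_ge

/-- The zeros `r` of degree `n - 1` at `b * q ^ 2` separate the two: `m j ≤ r j` by monotonicity,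
and `r j < l (j + 1)` by the recurrence interlacing. -/
theorem IsZeroSeq.le_succ (hq0 : 0 < q) (hq1 : q < 1) {n : ℕ} {b c : ℝ} {l m : ℕ → ℝ}
    (hcb : c ≤ b * q ^ 2) (hb : b < 0) (hl : IsZeroSeq q n b l)
    (hm : IsZeroSeq q n c m) {j : ℕ} (hj : j + 1 < n) : m j ≤ l (j + 1) := by
  obtain ⟨k, rfl⟩ : ∃ k, n = k + 1 := ⟨n - 1, by omega⟩
  have hbq : b * q ^ 2 < 0 := mul_neg_of_neg_of_pos hb (pow_pos hq0 2)
  obtain ⟨r, hr⟩ := exists_isZeroSeq hq0 hq1 k hbq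
  have h1 := IsZeroSeq.le_of_le hq0 hq1 k.le_succ hcb hbq hr hm (j := j) (by omega)
  exact h1.trans ((hl.interlace hq0 hq1 hb hr).2 j (j + 1) j.lt_succ_self (by omega)).le

/-- The appended value `l n = 1` makes the ratio bound at the last zero say that it is below `q`. -/
theorem IsZeroSeq.lt_q {n : ℕ} {b : ℝ} {l : ℕ → ℝ} (hq0 : 0 < q) (hq1 : q < 1)
    (h : IsZeroSeq q n b l) {j : ℕ} (hj : j < n) : l j < q := by
  have h1 := (h.strictMono hq0 hq1).monotone (Nat.succ_le_of_lt hj)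
  rw [h.eq_one] at h1
  exact (h.lt_mul j).trans_le (mul_le_of_le_one_right hq0.le h1)

end

theorem theorem3 (q : ℝ) (hq0 : 0 < q) (hq1 : q < 1) (n : ℕ) (b : ℝ) (hb : b < 0) :
    ((qBessel q n b).natDegree = n ∧ (qBesselDilated q n b).natDegree = n) ∧
    (qBessel q n b ∈ polysWithMesh n q (Set.Ioo 0 1) ∧
      qBesselDilated q n b ∈ polysWithMesh n q (Set.Ioo 0 1)) ∧
    (∀ t : ℝ, q ^ 2 < t → t < 1 →
      Interlaces (qBessel q n b) (qBessel q n (t * b)) ∧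
      Interlaces (qBesselDilated q n b) (qBesselDilated q n (t * b))) := by
  obtain ⟨l, hl⟩ := exists_isZeroSeq hq0 hq1 n hb
  have h0 := hl.pos_zero
  have hmono := hl.strictMono hq0 hq1
  have hpos := pos_of_strictMono h0 hmono
  have hdil : ∀ {m : ℕ → ℝ}, 0 < m 0 → StrictMono m →
      0 < m 0 / q ∧ StrictMono fun j => m j / q := fun h h' =>
    ⟨div_pos h hq0, fun _ _ hij => div_lt_div_of_pos_right (h' hij) hq0⟩
  obtain ⟨d0, dmono⟩ := hdil h0 hmono
  have e : qBesselDilated q n b = zeroPoly n fun j => l j / q := by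
    rw [qBesselDilated, hl.eq_zeroPoly, zeroPoly_comp]
  refine ⟨?_, ⟨⟨?_, ?_⟩, ?_, ?_⟩, fun t ht ht1 => ?_⟩
  · rw [e, hl.eq_zeroPoly]
    exact ⟨natDegree_zeroPoly h0 hmono n, natDegree_zeroPoly d0 dmono n⟩
  · rw [hl.eq_zeroPoly]
    exact zeroPoly_mem_polysWithZerosIn h0 hmono fun j hj =>
      ⟨hpos j, (hl.lt_q hq0 hq1 hj).trans hq1⟩
  · rw [hl.eq_zeroPoly]
    exact lmesh_zeroPoly_lt h0 hmono hq0 fun j _ => hl.lt_mul j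
  · rw [e]
    exact zeroPoly_mem_polysWithZerosIn d0 dmono fun j hj =>
      ⟨div_pos (hpos j) hq0, (div_lt_one hq0).2 (hl.lt_q hq0 hq1 hj)⟩
  · rw [e]
    refine lmesh_zeroPoly_lt d0 dmono hq0 fun j _ => ?_
    rw [← mul_div_assoc]
    exact div_lt_div_of_pos_right (hl.lt_mul j) hq0
  · have htb : t * b < 0 := mul_neg_of_pos_of_neg ((pow_pos hq0 2).trans ht) hb
    obtain ⟨m, hm⟩ := exists_isZeroSeq hq0 hq1 n htb
    have hmono' := hm.strictMono hq0 hq1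
    obtain ⟨d0', dmono'⟩ := hdil hm.pos_zero hmono'
    have e' : qBesselDilated q n (t * b) = zeroPoly n fun j => m j / q := by
      rw [qBesselDilated, hm.eq_zeroPoly, zeroPoly_comp]
    have h1 : ∀ j < n, l j ≤ m j := fun j hj =>
      IsZeroSeq.le_of_le hq0 hq1 le_rfl (by nlinarith) htb hm hl hj
    -- Here `q ^ 2 < t` enters: as `b < 0`, it gives `t * b ≤ b * q ^ 2`.
    have h2 : ∀ j, j + 1 < n → m j ≤ l (j + 1) := fun j hj =>
      IsZeroSeq.le_succ hq0 hq1 (by nlinarith) hb hl hm hj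
    rw [e, e', hl.eq_zeroPoly, hm.eq_zeroPoly]
    exact ⟨interlaces_zeroPoly h0 hmono hm.pos_zero hmono' h1 h2,
      interlaces_zeroPoly d0 dmono d0' dmono'
        (fun j hj => div_le_div_of_nonneg_right (h1 j hj) hq0.le)
        fun j hj => div_le_div_of_nonneg_right (h2 j hj) hq0.le⟩
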